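/- Let $1\le d_1<d$, let $\mathbf F=F_1\times\cdots\times F_d$ be a product of continuous probability distributions on $\mathbb R$, and let $\Omega\subseteq\mathbb R^d$ have full $\mathbf F$-measure. Let $f:\Omega\to\mathbb R$ be Lipschitz continuous. For $\mathbf v,\mathbf z\in\Omega$ let $D_{\mathbf z}f(\mathbf v,\mathbf z)\in\mathbb R^d$ be the vector with $i$-th entry $$\frac{f(\mathbf v_{\{i\}}{:}\mathbf z_{-\{i\}})-f(\mathbf z)}{v_i-z_i},$$ where $(\mathbf v_{\{i\}}{:}\mathbf z_{-\{i\}})$ is $\mathbf z$ with its $i$-th entry replaced by $v_i$; assume that, for some constant $L$, $\|D_{\mathbf z}f(\mathbf v,\mathbf z)\|\le L$ for all $\mathbf v,\mathbf z\in\Omega$ for which this vector is defined (that is, $v_i\ne z_i$ and $(\mathbf v_{\{i\}}{:}\mathbf z_{-\{i\}})\in\Omega$ for every $i$). Vector norms are Euclidean and matrix norms are spectral. For independent $\mathbf v,\mathbf z\sim\mathbf F$ put $\mathbf C(\mathbf z)=\mathrm E[(D_{\mathbf z}f)(D_{\mathbf z}f)^T\mid\mathbf z]$ and $\mathbf C=\mathrm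 E[\mathbf C(\mathbf z)]$. Let $\mathbf C=\mathbf U\,\mathrm{diag}(\lambda_1,\dots,\lambda_d)\,\mathbf U^T$ with $\mathbf U=[\mathbf U_1\ \mathbf U_2]$ orthogonal, $\lambda_1\ge\cdots\ge\lambda_d$, where $\mathbf U_1$ consists of the first $d_1$ columns, and assume $\lambda_{d_1}>\lambda_{d_1+1}$. Let $\mathbf z^{(j)}$, $\mathbf v^{(j,i)}$ ($i,j\ge1$) be independent samples from $\mathbf F$, put $\mathbf C_j=\mathbf C(\mathbf z^{(j)})$ and $$\hat{\mathbf C}=\frac1{M_1M_2}\sum_{j=1}^{M_1}\sum_{i=1}^{M_2}\bigl(D_{\mathbf z^{(j)}}f(\mathbf v^{(j,i)},\mathbf z^{(j)})\bigr)\bigl(D_{\mathbf z^{(j)}}f(\mathbf v^{(j,i)},\mathbf z^{(j)})\bigr)^T .$$ Let $\varepsilon',\varepsilon''>0$. Then for every $\eta>0$ there is $M_0$ such that for all $M_1,M_2\ge M_0$ there is an event of probability at least $1-\eta$ on which $$\|\hat{\mathbf C}-\mathbf C\|\le\frac{\varepsilon''}{M_1}\sum_{j=1}^{M_1}\|\mathbf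 C_j\|+\varepsilon'\|\mathbf C\|$$ and on which, whenever the sample satisfies $$\frac{\varepsilon''}{M_1}\sum_{j=1}^{M_1}\|\mathbf C_j\|+\varepsilon'\lambda_1\le\frac{\lambda_{d_1}-\lambda_{d_1+1}}5,$$ every eigenvalue decomposition $\hat{\mathbf C}=\hat{\mathbf U}\hat\Lambda\hat{\mathbf U}^T$ with $\hat{\mathbf U}$ orthogonal and the eigenvalues in decreasing order satisfies $$\|\mathbf U_1^T\hat{\mathbf U}_2\|\le\frac{4\left(\frac{\varepsilon''}{M_1}\sum_{j=1}^{M_1}\|\mathbf C_j\|+\varepsilon'\lambda_1\right)}{\lambda_{d_1}-\lambda_{d_1+1}},$$ where $\hat{\mathbf U}_2$ consists of the last $d-d_1$ columns of $\hat{\mathbf U}$. -/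

import Mathlib

open MeasureTheory ProbabilityTheory
open scoped Matrix Matrix.Norms.L2Operator

noncomputable section GlobalActiveSubspace

/-- The vector of first-order divided differences `D_z f (v, z)`. Its `i`-th entry is
`(f (v_{i} : z_{-i}) - f z) / (v i - z i)`, where `(v_{i} : z_{-i})` is `z` with its `i`-th entry
replaced by `v i`. -/
def dividedDiff {d : ℕ} (f : (Fin d → ℝ) → ℝ) (v z : Fin d → ℝ) : Fin d → ℝ :=
  fun i => (f (Function.update z i (v i)) - f z) / (v i - z i)

/-- The matrix `(D_z f (v, z)) (D_z f (v, z))ᵀ`. -/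
def dividedDiffOuter {d : ℕ} (f : (Fin d → ℝ) → ℝ) (v z : Fin d → ℝ) :
    Matrix (Fin d) (Fin d) ℝ :=
  Matrix.vecMulVec (dividedDiff f v z) (dividedDiff f v z)

/-- `E[(D_z f) (D_z f)ᵀ | z]`: here `z` is fixed and `v` is averaged, entry by entry, over the
product distribution with marginals `μ i`. -/
def condGasMatrix {d : ℕ} (μ : Fin d → Measure ℝ) (f : (Fin d → ℝ) → ℝ) (z : Fin d → ℝ) :
    Matrix (Fin d) (Fin d) ℝ :=
  Matrix.of fun a b => ∫ v, dividedDiffOuter f v z a b ∂(Measure.pi μ)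

/-- `C = E[E[(D_z f) (D_z f)ᵀ | z]]`. -/
def gasMatrix {d : ℕ} (μ : Fin d → Measure ℝ) (f : (Fin d → ℝ) → ℝ) :
    Matrix (Fin d) (Fin d) ℝ :=
  Matrix.of fun a b => ∫ z, condGasMatrix μ f z a b ∂(Measure.pi μ)

/-- The Monte Carlo estimator
`Ĉ = (1 / (M₁ M₂)) ∑ⱼ ∑ᵢ (D_{z j} f (v j i, z j)) (D_{z j} f (v j i, z j))ᵀ`
for the sample points `z j` and `v j i`, `j < M₁`, `i < M₂`. -/
def gasEstimator {d : ℕ} (f : (Fin d → ℝ) → ℝ) (M₁ M₂ : ℕ)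
    (z : ℕ → Fin d → ℝ) (v : ℕ → ℕ → Fin d → ℝ) : Matrix (Fin d) (Fin d) ℝ :=
  (1 / ((M₁ : ℝ) * (M₂ : ℝ))) •
    ∑ j ∈ Finset.range M₁, ∑ i ∈ Finset.range M₂, dividedDiffOuter f (v j i) (z j)

/-- `A = U diag(l₁, …, l_d) Uᵀ` with `U` orthogonal and `l₁ ≥ ⋯ ≥ l_d`. -/
def IsOrderedEigendecomposition {d : ℕ} (A U : Matrix (Fin d) (Fin d) ℝ) (l : Fin d → ℝ) : Prop :=
  U ∈ Matrix.orthogonalGroup (Fin d) ℝ ∧ Antitone l ∧ A = U * Matrix.diagonal l * Uᵀ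

/-- `U₁`: the first `d₁` columns of `U = [U₁ U₂]`. -/
def leadingColumns {d : ℕ} (d₁ : ℕ) (U : Matrix (Fin d) (Fin d) ℝ) :
    Matrix (Fin d) {k : Fin d // (k : ℕ) < d₁} ℝ :=
  U.submatrix id Subtype.val

/-- `U₂`: the remaining `d - d₁` columns of `U = [U₁ U₂]`. -/
def trailingColumns {d : ℕ} (d₁ : ℕ) (U : Matrix (Fin d) (Fin d) ℝ) :
    Matrix (Fin d) {k : Fin d // d₁ ≤ (k : ℕ)} ℝ :=
  U.submatrix id Subtype.val

end GlobalActiveSubspace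

/-! The proof combines a concentration estimate with a deterministic perturbation bound. Almost
surely each entry of `dividedDiffOuter` is at most `L ^ 2` in absolute value, and its mean is the
entry of `C`. Terms with different outer index `j` are independent, so the variance of an entry of
`Ĉ` is `O(1/M₁)`, whatever `M₂` is. Chebyshev and a union bound over the entries give `‖Ĉ - C‖ ≤ ε'
‖C‖` with high probability (`exists_forall_measure_gasEstimator_error_le`); the nonnegative `ε''`
term only weakens this.

For the subspaces, let `e` bound `‖Ĉ - C‖`. Weyl's inequality puts the trailing eigenvalues of `Ĉ`
below `λ_{d₁+1} + e`, hence, if `e` is at most a fifth of the gap, at least 4/5 of the gap below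
`λ_{d₁}`. The matrix `X = U₁ᵀ Û₂` solves the Sylvester equation `Λ₁ X - X Λ̂₂ = U₁ᵀ (C - Ĉ) Û₂`, and
the separation of the spectra bounds `‖X‖`. Since `C` is positive semidefinite, `‖C‖ ≤ λ₁`, which
gives the stated form. -/

/-! ### Eigenvalue and eigenspace perturbation -/

section LinearAlgebra

open Matrix

variable {d : ℕ} {A B U V : Matrix (Fin d) (Fin d) ℝ} {l m : Fin d → ℝ}

theorem abs_quadForm_le_norm (A : Matrix (Fin d) (Fin d) ℝ) (x : Fin d → ℝ) :
    |x ⬝ᵥ A *ᵥ x| ≤ ‖A‖ * (x ⬝ᵥ x) := by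
  have h1 := A.l2_opNorm_mulVec (WithLp.toLp 2 x)
  have h2 := abs_real_inner_le_norm (WithLp.toLp 2 (A *ᵥ x)) (WithLp.toLp 2 x)
  have h3 : ‖WithLp.toLp 2 x‖ * ‖WithLp.toLp 2 x‖ = x ⬝ᵥ x := by
    rw [← real_inner_self_eq_norm_mul_norm, EuclideanSpace.inner_toLp_toLp]
    simp
  rw [EuclideanSpace.inner_toLp_toLp] at h2
  simp only [star_trivial] at h2
  calc |x ⬝ᵥ A *ᵥ x| ≤ ‖WithLp.toLp 2 (A *ᵥ x)‖ * ‖WithLp.toLp 2 x‖ := h2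
    _ ≤ (‖A‖ * ‖WithLp.toLp 2 x‖) * ‖WithLp.toLp 2 x‖ := by gcongr; exact h1
    _ = _ := by rw [mul_assoc, h3]

theorem norm_le_one_of_transpose_mul_self {k : Type*} [Fintype k] [DecidableEq k]
    {W : Matrix (Fin d) k ℝ} (h : Wᵀ * W = 1) : ‖W‖ ≤ 1 := by
  have h1 : ‖W‖ * ‖W‖ = ‖(1 : Matrix k k ℝ)‖ := by
    rw [← Matrix.l2_opNorm_conjTranspose_mul_self, Matrix.conjTranspose_eq_transpose_of_trivial, h]
  have h2 : ‖(1 : Matrix k k ℝ)‖ ≤ 1 := by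
    rw [← Matrix.diagonal_one, Matrix.l2_opNorm_diagonal]
    exact (pi_norm_le_iff_of_nonneg zero_le_one).2 fun _ => by simp
  nlinarith [norm_nonneg W]

theorem submatrix_transpose_mul_self {k : Type*} [Fintype k] [DecidableEq k] {e : k → Fin d}
    (he : Function.Injective e) (hU : Uᵀ * U = 1) :
    (U.submatrix id e)ᵀ * U.submatrix id e = 1 := by
  ext i j
  have := congrFun (congrFun hU (e i)) (e j)
  simpa [Matrix.mul_apply, Matrix.one_apply, he.eq_iff] using this

namespace IsOrderedEigendecomposition

theorem transpose_mul_self (h : IsOrderedEigendecomposition A U l) : Uᵀ * U = 1 := by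
  simpa [Matrix.star_eq_conjTranspose] using (Matrix.mem_orthogonalGroup_iff' (Fin d) ℝ).1 h.1

theorem mul_transpose_self (h : IsOrderedEigendecomposition A U l) : U * Uᵀ = 1 := by
  simpa [Matrix.star_eq_conjTranspose] using (Matrix.mem_orthogonalGroup_iff (Fin d) ℝ).1 h.1

theorem quadForm_eq (h : IsOrderedEigendecomposition A U l) (x : Fin d → ℝ) :
    x ⬝ᵥ A *ᵥ x = ∑ k, l k * ((Uᵀ *ᵥ x) k) ^ 2 := by
  rw [h.2.2, ← Matrix.mulVec_mulVec, ← Matrix.mulVec_mulVec, Matrix.dotProduct_mulVec,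
    ← Matrix.mulVec_transpose]
  simp only [dotProduct, Matrix.mulVec_diagonal]
  exact Finset.sum_congr rfl fun k _ => by ring

theorem dotProduct_self_eq (h : IsOrderedEigendecomposition A U l) (x : Fin d → ℝ) :
    x ⬝ᵥ x = ∑ k, ((Uᵀ *ᵥ x) k) ^ 2 := by
  have : (Uᵀ *ᵥ x) ⬝ᵥ (Uᵀ *ᵥ x) = x ⬝ᵥ x := by
    rw [Matrix.dotProduct_mulVec, Matrix.vecMul_transpose, Matrix.mulVec_mulVec,
      h.mul_transpose_self, Matrix.one_mulVec]
  rw [← this, dotProduct]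
  exact Finset.sum_congr rfl fun k _ => by ring

theorem mul_submatrix (h : IsOrderedEigendecomposition A U l) {k : Type*} [Fintype k]
    [DecidableEq k] (e : k → Fin d) :
    A * U.submatrix id e = U.submatrix id e * Matrix.diagonal (l ∘ e) := by
  have h1 : A * U = U * Matrix.diagonal l := by
    rw [h.2.2, Matrix.mul_assoc, h.transpose_mul_self, Matrix.mul_one]
  ext i j
  have := congrFun (congrFun h1 i) (e j)
  rw [Matrix.mul_diagonal] at this ⊢
  simpa [Matrix.mul_apply] using this

theorem isSymm (h : IsOrderedEigendecomposition A U l) : Aᵀ = A := by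
  rw [h.2.2]
  simp [Matrix.transpose_mul, Matrix.mul_assoc]

/-- Semidefiniteness makes all eigenvalues nonnegative, so the first is also the largest in absolute
value. -/
theorem norm_le (h : IsOrderedEigendecomposition A U l) (hA : ∀ x, 0 ≤ x ⬝ᵥ A *ᵥ x) (hd : 0 < d) :
    ‖A‖ ≤ l ⟨0, hd⟩ := by
  have hl : ∀ k, 0 ≤ l k := by
    intro k
    have h1 := hA (U *ᵥ Pi.single k 1)
    rw [h.quadForm_eq, Matrix.mulVec_mulVec, h.transpose_mul_self, Matrix.one_mulVec,
      Finset.sum_eq_single k] at h1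
    · simpa using h1
    · intro b _ hb; simp [hb]
    · simp
  have hU : ‖U‖ ≤ 1 := norm_le_one_of_transpose_mul_self h.transpose_mul_self
  have hUt : ‖Uᵀ‖ ≤ 1 := norm_le_one_of_transpose_mul_self
    (by rw [Matrix.transpose_transpose]; exact h.mul_transpose_self)
  have hD : ‖Matrix.diagonal l‖ ≤ l ⟨0, hd⟩ := by
    rw [Matrix.l2_opNorm_diagonal]
    refine (pi_norm_le_iff_of_nonneg (hl _)).2 fun k => ?_
    rw [Real.norm_of_nonneg (hl k)]
    exact h.2.1 (Fin.mk_le_of_le_val (Nat.zero_le _))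
  calc ‖A‖ = ‖U * Matrix.diagonal l * Uᵀ‖ := by rw [← h.2.2]
    _ ≤ ‖U‖ * ‖Matrix.diagonal l‖ * ‖Uᵀ‖ :=
        (Matrix.l2_opNorm_mul _ _).trans (by gcongr; exact Matrix.l2_opNorm_mul _ _)
    _ ≤ 1 * l ⟨0, hd⟩ * 1 := by gcongr; exact mul_nonneg zero_le_one (hl _)
    _ = _ := by ring

/-- Weyl's inequality. -/
theorem eigenvalue_le_add_norm_sub (hA : IsOrderedEigendecomposition A U l)
    (hB : IsOrderedEigendecomposition B V m) (k : Fin d) : m k ≤ l k + ‖B - A‖ := by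
  -- The zero row makes `W` singular. A kernel vector is orthogonal to the eigenvectors of `A`
  -- before `k` and to those of `B` after `k`, so it compares `l k` with `m k`.
  let W : Matrix (Fin d) (Fin d) ℝ := Matrix.of fun i j =>
    if i < k then Uᵀ i j else if i = k then 0 else Vᵀ i j
  have hdet : W.det = 0 := Matrix.det_eq_zero_of_row_eq_zero k fun j => by simp [W]
  obtain ⟨x, hx0, hx⟩ := Matrix.exists_mulVec_eq_zero_iff.2 hdet
  have hxU : ∀ i < k, (Uᵀ *ᵥ x) i = 0 := fun i hi => by
    have := congrFun hx i
    simpa [W, Matrix.mulVec, dotProduct, hi] using this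
  have hxV : ∀ i, k < i → (Vᵀ *ᵥ x) i = 0 := fun i hi => by
    have := congrFun hx i
    simpa [W, Matrix.mulVec, dotProduct, hi.not_gt, hi.ne'] using this
  have h1 : x ⬝ᵥ A *ᵥ x ≤ l k * (x ⬝ᵥ x) := by
    rw [hA.quadForm_eq, hA.dotProduct_self_eq, Finset.mul_sum]
    refine Finset.sum_le_sum fun i _ => ?_
    rcases lt_or_ge i k with hi | hi
    · simp [hxU i hi]
    · exact mul_le_mul_of_nonneg_right (hA.2.1 hi) (sq_nonneg _)
  have h2 : m k * (x ⬝ᵥ x) ≤ x ⬝ᵥ B *ᵥ x := by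
    rw [hB.quadForm_eq, hB.dotProduct_self_eq, Finset.mul_sum]
    refine Finset.sum_le_sum fun i _ => ?_
    rcases lt_or_ge k i with hi | hi
    · simp [hxV i hi]
    · exact mul_le_mul_of_nonneg_right (hB.2.1 hi) (sq_nonneg _)
  have h3 := (le_abs_self _).trans (abs_quadForm_le_norm (B - A) x)
  rw [Matrix.sub_mulVec, dotProduct_sub] at h3
  have h4 : 0 < x ⬝ᵥ x := by
    rw [dotProduct]
    obtain ⟨i, hi⟩ := Function.ne_iff.1 hx0
    exact Finset.sum_pos' (fun _ _ => mul_self_nonneg _) ⟨i, Finset.mem_univ _,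
      mul_self_pos.2 hi⟩
  refine le_of_mul_le_mul_right ?_ h4
  linarith

end IsOrderedEigendecomposition

/-- If the diagonal matrices `diag p`, `diag q` have spectra separated by a gap, the solution `X`
of the Sylvester equation with right-hand side `diag p * X - X * diag q` is controlled. -/
theorem gap_mul_norm_le_norm_sylvester {k n : Type*} [Fintype k] [DecidableEq k] [Fintype n]
    [DecidableEq n] (X : Matrix k n ℝ) {p : k → ℝ} {q : n → ℝ} {α β : ℝ}
    (hp : ∀ i, α ≤ p i) (hq : ∀ j, q j ≤ β) (hαβ : β < α) :
    (α - β) * ‖X‖ ≤ ‖Matrix.diagonal p * X - X * Matrix.diagonal q‖ := by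
  obtain ⟨s, hs⟩ : ∃ s, ∀ j, s ≤ q j := (Set.finite_range q).bddBelow.imp fun s h j => h ⟨j, rfl⟩
  -- After shifting by `t`, `q - t` lies in `[0, β - t]` and `p - t ≥ α - t > 0`. The minimum with
  -- `β` covers an empty `n`, where `s` is arbitrary.
  set t := min s β
  have ht : t ≤ β := min_le_right _ _
  have hαt : 0 < α - t := by linarith
  have hpt : ∀ i, 0 < p i - t := fun i => by linarith [hp i]
  set E := Matrix.diagonal p * X - X * Matrix.diagonal q with hE
  have hXE : X = Matrix.diagonal (fun i => (p i - t)⁻¹) *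
      (E + X * Matrix.diagonal (fun j => q j - t)) := by
    ext i j
    rw [Matrix.diagonal_mul, hE, Matrix.add_apply, Matrix.sub_apply, Matrix.diagonal_mul,
      Matrix.mul_diagonal, Matrix.mul_diagonal]
    have := (hpt i).ne'
    field_simp
    ring
  have hD1 : ‖Matrix.diagonal (fun i => (p i - t)⁻¹)‖ ≤ (α - t)⁻¹ := by
    rw [Matrix.l2_opNorm_diagonal]
    refine (pi_norm_le_iff_of_nonneg (inv_nonneg.2 hαt.le)).2 fun i => ?_
    rw [Real.norm_of_nonneg (inv_nonneg.2 (hpt i).le)]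
    exact inv_anti₀ hαt (by linarith [hp i])
  have hD2 : ‖Matrix.diagonal (fun j => q j - t)‖ ≤ β - t := by
    rw [Matrix.l2_opNorm_diagonal]
    refine (pi_norm_le_iff_of_nonneg (by linarith)).2 fun j => ?_
    rw [Real.norm_of_nonneg (by linarith [hs j, min_le_left s β])]
    linarith [hq j]
  have h1 : ‖X‖ ≤ (α - t)⁻¹ * (‖E‖ + ‖X‖ * (β - t)) := by
    calc ‖X‖ = ‖Matrix.diagonal (fun i => (p i - t)⁻¹) *
          (E + X * Matrix.diagonal (fun j => q j - t))‖ := by rw [← hXE]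
      _ ≤ ‖Matrix.diagonal (fun i => (p i - t)⁻¹)‖ *
          (‖E‖ + ‖X‖ * ‖Matrix.diagonal (fun j => q j - t)‖) :=
        (Matrix.l2_opNorm_mul _ _).trans (by
          gcongr; exact (norm_add_le _ _).trans (by gcongr; exact Matrix.l2_opNorm_mul _ _))
      _ ≤ _ := by gcongr
  -- Now `(α - t) ‖X‖ ≤ ‖E‖ + (β - t) ‖X‖`, and `t` cancels.
  rw [inv_mul_eq_div, le_div_iff₀ hαt] at h1
  linarith

/-- If the columns of `U₁` and `V₂` are eigenvectors of `A` and `B` with separated eigenvalues, the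
norm of `U₁ᵀ * V₂` is controlled by the distance from `A` to `B`. -/
theorem gap_mul_norm_transpose_mul_le {k n : Type*} [Fintype k] [DecidableEq k] [Fintype n]
    [DecidableEq n] {U₁ : Matrix (Fin d) k ℝ} {V₂ : Matrix (Fin d) n ℝ} {p : k → ℝ} {q : n → ℝ}
    {α β : ℝ} (hA : Aᵀ = A) (hAU : A * U₁ = U₁ * Matrix.diagonal p)
    (hBV : B * V₂ = V₂ * Matrix.diagonal q) (hU : U₁ᵀ * U₁ = 1) (hV : V₂ᵀ * V₂ = 1)
    (hp : ∀ i, α ≤ p i) (hq : ∀ j, q j ≤ β) (hαβ : β < α) :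
    (α - β) * ‖U₁ᵀ * V₂‖ ≤ ‖B - A‖ := by
  have e1 : U₁ᵀ * A = Matrix.diagonal p * U₁ᵀ := by
    have := congrArg Matrix.transpose hAU
    rwa [Matrix.transpose_mul, Matrix.transpose_mul, hA, Matrix.diagonal_transpose] at this
  have n1 : ‖U₁ᵀ‖ ≤ 1 := by
    rw [← Matrix.conjTranspose_eq_transpose_of_trivial, Matrix.l2_opNorm_conjTranspose]
    exact norm_le_one_of_transpose_mul_self hU
  have n2 : ‖V₂‖ ≤ 1 := norm_le_one_of_transpose_mul_self hV
  have e3 : Matrix.diagonal p * (U₁ᵀ * V₂) - (U₁ᵀ * V₂) * Matrix.diagonal q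
      = U₁ᵀ * (-(B - A)) * V₂ := by
    rw [← Matrix.mul_assoc, ← e1, Matrix.mul_assoc U₁ᵀ V₂, ← hBV, neg_sub, Matrix.mul_sub,
      Matrix.sub_mul, Matrix.mul_assoc U₁ᵀ B V₂]
  calc _ ≤ ‖U₁ᵀ * (-(B - A)) * V₂‖ :=
        e3 ▸ gap_mul_norm_le_norm_sylvester (U₁ᵀ * V₂) hp hq hαβ
    _ ≤ ‖U₁ᵀ‖ * ‖-(B - A)‖ * ‖V₂‖ :=
        (Matrix.l2_opNorm_mul _ _).trans (by gcongr; exact Matrix.l2_opNorm_mul _ _)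
    _ ≤ 1 * ‖B - A‖ * 1 := by rw [norm_neg]; gcongr
    _ = ‖B - A‖ := by ring

/-- A one-sided `sin Θ` theorem for the leading eigenspace. -/
theorem norm_leadingColumns_transpose_mul_trailingColumns_le {d₁ : ℕ} {r s : Fin d}
    (hr : (r : ℕ) = d₁ - 1) (hs : (s : ℕ) = d₁)
    (hA : IsOrderedEigendecomposition A U l) (hB : IsOrderedEigendecomposition B V m)
    (hgap : l s < l r) {e : ℝ} (hBA : ‖B - A‖ ≤ e)
    (he : e ≤ (l r - l s) / 5) :
    ‖(leadingColumns d₁ U)ᵀ * trailingColumns d₁ V‖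
      ≤ 4 * e / (l r - l s) := by
  have key : (l r - (l s + e)) *
      ‖(leadingColumns d₁ U)ᵀ * trailingColumns d₁ V‖ ≤ ‖B - A‖ :=
    gap_mul_norm_transpose_mul_le hA.isSymm (hA.mul_submatrix _) (hB.mul_submatrix _)
      (submatrix_transpose_mul_self Subtype.val_injective hA.transpose_mul_self)
      (submatrix_transpose_mul_self Subtype.val_injective hB.transpose_mul_self)
      (fun i => hA.2.1 (show i.1 ≤ r from Fin.le_def.2 (hr ▸ Nat.le_sub_one_of_lt i.2)))
      (fun j => (hB.2.1 (show s ≤ j.1 from Fin.le_def.2 (hs ▸ j.2))).trans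
        ((hA.eigenvalue_le_add_norm_sub hB _).trans (by gcongr)))
      (by linarith)
  have e0 : 0 ≤ e := (norm_nonneg _).trans hBA
  generalize ‖(leadingColumns d₁ U)ᵀ * trailingColumns d₁ V‖ = x at key ⊢
  have hδ0 := sub_pos.2 hgap
  rw [le_div_iff₀ hδ0]
  -- For `x > 0`, `e ≤ gap / 5` turns `key` into `(4/5) gap * x ≤ e`; the constant 4 leaves room
  -- over 5/4.
  rcases le_or_gt x 0 with hx | hx
  · nlinarith
  · nlinarith

end LinearAlgebra

/-! ### Chebyshev bound for partially dependent averages -/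

section Concentration

variable {S : Type*} [MeasurableSpace S] {P : Measure S} [IsProbabilityMeasure P]

theorem covariance_le_of_abs_le {X Y : S → ℝ} {c : ℝ} (hX : ∀ᵐ ω ∂P, |X ω| ≤ c)
    (hY : ∀ᵐ ω ∂P, |Y ω| ≤ c) : cov[X, Y; P] ≤ 4 * c ^ 2 := by
  have aux : ∀ {Z : S → ℝ}, (∀ᵐ ω ∂P, |Z ω| ≤ c) → |∫ ω, Z ω ∂P| ≤ c := fun h => by
    simp only [← Real.norm_eq_abs] at h ⊢
    simpa using norm_integral_le_of_norm_le_const h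
  have h : ∀ᵐ ω ∂P, ‖(X ω - P[X]) * (Y ω - P[Y])‖ ≤ 4 * c ^ 2 := by
    filter_upwards [hX, hY] with ω h1 h2
    have h3 := (abs_sub (X ω) P[X]).trans (add_le_add h1 (aux hX))
    have h4 := (abs_sub (Y ω) P[Y]).trans (add_le_add h2 (aux hY))
    rw [norm_mul, Real.norm_eq_abs, Real.norm_eq_abs]
    calc _ ≤ (c + c) * (c + c) := mul_le_mul h3 h4 (abs_nonneg _) ((abs_nonneg _).trans h3)
      _ = _ := by ring
  have := norm_integral_le_of_norm_le_const h
  rw [covariance]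
  exact (le_abs_self _).trans (by simpa using this)

/-- Chebyshev's inequality for a doubly indexed average whose terms are independent across
different first indices. -/
theorem measure_le_abs_average_sub_le {X : ℕ → ℕ → S → ℝ} {c m : ℝ}
    (hX : ∀ j i, AEMeasurable (X j i) P) (hc : ∀ j i, ∀ᵐ ω ∂P, |X j i ω| ≤ c)
    (hm : ∀ j i, ∫ ω, X j i ω ∂P = m)
    (hind : ∀ j i j' i', j ≠ j' → IndepFun (X j i) (X j' i') P)
    {M₁ M₂ : ℕ} (hM₁ : 0 < M₁) (hM₂ : 0 < M₂) {δ : ℝ} (hδ : 0 < δ) :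
    P {ω | δ ≤ |1 / ((M₁ : ℝ) * M₂) * ∑ j ∈ Finset.range M₁, ∑ i ∈ Finset.range M₂, X j i ω - m|}
      ≤ ENNReal.ofReal (4 * c ^ 2 / δ ^ 2 / M₁) := by
  have hM₁' : (0 : ℝ) < M₁ := by exact_mod_cast hM₁
  have hM₂' : (0 : ℝ) < M₂ := by exact_mod_cast hM₂
  have hL : ∀ j i, MemLp (X j i) 2 P := fun j i =>
    MemLp.of_bound (hX j i).aestronglyMeasurable c (hc j i)
  set s := Finset.range M₁ ×ˢ Finset.range M₂
  set T : S → ℝ := fun ω => ∑ p ∈ s, X p.1 p.2 ω with hT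
  have hTL : MemLp T 2 P := memLp_finsetSum _ fun p _ => hL p.1 p.2
  have hTm : P[T] = M₁ * M₂ * m := by
    rw [hT, integral_finsetSum _ fun p _ => (hL p.1 p.2).integrable one_le_two]
    simp [hm, s]
  have hTv : Var[T; P] ≤ M₁ * M₂ ^ 2 * (4 * c ^ 2) := by
    rw [hT, variance_fun_sum' (X := fun p : ℕ × ℕ => X p.1 p.2) fun p _ => hL p.1 p.2]
    -- Only the `M₁ * M₂ ^ 2` pairs with equal first index contribute; dividing by `(M₁ * M₂) ^ 2`
    -- leaves `1 / M₁`.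
    calc _ ≤ ∑ p ∈ s, ∑ q ∈ s, if p.1 = q.1 then 4 * c ^ 2 else 0 := by
          gcongr with p _ q _
          split_ifs with h
          · exact covariance_le_of_abs_le (hc _ _) (hc _ _)
          · exact ((hind _ _ _ _ h).covariance_eq_zero (hL _ _) (hL _ _)).le
      _ = ∑ p ∈ s, M₂ * (4 * c ^ 2) := by
          refine Finset.sum_congr rfl fun p hp => ?_
          rw [Finset.sum_product_right]
          have : p.1 ∈ Finset.range M₁ := (Finset.mem_product.1 hp).1
          simp only [Finset.sum_ite_eq, if_pos this, Finset.sum_const, Finset.card_range,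
            nsmul_eq_mul]
      _ = _ := by
          simp only [Finset.sum_const, s, Finset.card_product, Finset.card_range, nsmul_eq_mul,
            Nat.cast_mul]
          ring
  have hpos : 0 < δ * (M₁ * M₂) := by positivity
  refine (measure_mono fun ω hω => ?_).trans
    ((meas_ge_le_variance_div_sq hTL hpos).trans (ENNReal.ofReal_le_ofReal ?_))
  · have h1 : δ ≤ |1 / ((M₁ : ℝ) * M₂) * T ω - m| := by
      simpa only [hT, s, Finset.sum_product, Set.mem_ofPred_eq] using hω
    have h2 : T ω - P[T] = (1 / ((M₁ : ℝ) * M₂) * T ω - m) * (M₁ * M₂) := by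
      rw [hTm]; field_simp
    rw [Set.mem_ofPred_eq, h2, abs_mul, abs_of_pos (mul_pos hM₁' hM₂')]
    gcongr
  · rw [div_le_iff₀ (by positivity)]
    refine hTv.trans (le_of_eq ?_)
    field_simp

end Concentration

/-! ### Measurability, boundedness and moments of divided differences -/

section DividedDifferences

variable {d : ℕ} {μ : Fin d → Measure ℝ} {Ω : Set (Fin d → ℝ)} {f : (Fin d → ℝ) → ℝ}

/-- A Lipschitz extension of `f` from `Ω` to the whole space is continuous and agrees with `f`
almost everywhere; `Ω` itself need not be measurable. -/
theorem aemeasurable_of_lipschitz_on (hΩ : ∀ᵐ z ∂(Measure.pi μ), z ∈ Ω)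
    (hf : ∃ K : ℝ, ∀ x ∈ Ω, ∀ y ∈ Ω, |f x - f y| ≤ K * ‖WithLp.toLp 2 (x - y)‖) :
    AEMeasurable f (Measure.pi μ) := by
  obtain ⟨K, hK⟩ := hf
  have hlip : LipschitzOnWith K.toNNReal (f ∘ WithLp.ofLp)
      {x : EuclideanSpace ℝ (Fin d) | x.ofLp ∈ Ω} := by
    refine LipschitzOnWith.of_dist_le_mul fun x hx y hy => ?_
    rw [Real.dist_eq, dist_eq_norm]
    refine (hK _ hx _ hy).trans ?_
    gcongr
    · exact Real.le_coe_toNNReal K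
    · exact le_rfl
  obtain ⟨g, hg, hgf⟩ := hlip.extend_real
  refine ⟨g ∘ WithLp.toLp 2,
    hg.continuous.measurable.comp (PiLp.continuous_toLp 2 _).measurable, ?_⟩
  filter_upwards [hΩ] with x hx
  exact hgf (x := WithLp.toLp 2 x) hx

variable [∀ i, IsProbabilityMeasure (μ i)]

/-- Replacing one coordinate by an independent copy preserves a product law. Hence the updated point
is almost surely in `Ω`, and `f` stays a.e. measurable along the update. -/
theorem measurePreserving_update (i : Fin d) :
    MeasurePreserving (fun p : (Fin d → ℝ) × (Fin d → ℝ) => Function.update p.2 i (p.1 i))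
      ((Measure.pi μ).prod (Measure.pi μ)) (Measure.pi μ) := by
  have hmeas : Measurable
      (fun p : (Fin d → ℝ) × (Fin d → ℝ) => Function.update p.2 i (p.1 i)) := by
    refine measurable_pi_lambda _ fun j => ?_
    by_cases h : j = i
    · subst h; simp only [Function.update_self]; fun_prop
    · simp only [Function.update_of_ne h]; fun_prop
  refine ⟨hmeas, (Measure.pi_eq fun s hs => ?_).symm⟩
  have hpre : (fun p : (Fin d → ℝ) × (Fin d → ℝ) => Function.update p.2 i (p.1 i)) ⁻¹'
      Set.univ.pi s = (Function.eval i ⁻¹' s i) ×ˢ Set.univ.pi (Function.update s i Set.univ) := by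
    ext p
    simp only [Set.mem_preimage, Set.mem_univ_pi, Set.mem_prod, Function.eval]
    constructor
    · intro h
      refine ⟨by simpa using h i, fun j => ?_⟩
      by_cases hj : j = i
      · subst hj; simp
      · simpa [hj] using h j
    · rintro ⟨h1, h2⟩ j
      by_cases hj : j = i
      · subst hj; simpa using h1
      · simpa [hj] using h2 j
  rw [Measure.map_apply hmeas (.univ_pi hs), hpre, Measure.prod_prod, Measure.pi_pi,
    (measurePreserving_eval μ i).measure_preimage (hs i).nullMeasurableSet,
    ← Finset.mul_prod_erase Finset.univ (fun j => μ j (s j)) (Finset.mem_univ i),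
    ← Finset.mul_prod_erase Finset.univ (fun j => μ j (Function.update s i Set.univ j))
      (Finset.mem_univ i)]
  simp only [Function.update_self, measure_univ, one_mul]
  congr 1
  exact Finset.prod_congr rfl fun j hj => by rw [Function.update_of_ne (Finset.ne_of_mem_erase hj)]

theorem aemeasurable_dividedDiff (hf : AEMeasurable f (Measure.pi μ)) (i : Fin d) :
    AEMeasurable (fun p : (Fin d → ℝ) × (Fin d → ℝ) => dividedDiff f p.1 p.2 i)
      ((Measure.pi μ).prod (Measure.pi μ)) := by
  unfold dividedDiff
  refine AEMeasurable.div (AEMeasurable.sub ?_ ?_) ?_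
  · exact hf.comp_quasiMeasurePreserving (measurePreserving_update i).quasiMeasurePreserving
  · exact hf.comp_quasiMeasurePreserving Measure.quasiMeasurePreserving_snd
  · fun_prop

/-- Absence of atoms gives `v i ≠ z i` almost surely, so the convention for division by zero matters
only on a null set. -/
theorem ae_norm_dividedDiff_le [∀ i, NullSingletonClass (μ i)]
    (hΩ : ∀ᵐ z ∂(Measure.pi μ), z ∈ Ω) {L : ℝ}
    (hL : ∀ v ∈ Ω, ∀ z ∈ Ω, (∀ i, v i ≠ z i ∧ Function.update z i (v i) ∈ Ω) →
      ‖WithLp.toLp 2 (dividedDiff f v z)‖ ≤ L) :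
    ∀ᵐ p ∂((Measure.pi μ).prod (Measure.pi μ)), ‖WithLp.toLp 2 (dividedDiff f p.1 p.2)‖ ≤ L := by
  have hne : ∀ i, ∀ᵐ p ∂((Measure.pi μ).prod (Measure.pi μ)), p.1 i ≠ p.2 i := by
    intro i
    refine (Measure.ae_prod_iff_ae_ae ?_).2 (.of_forall fun x => ?_)
    · exact (measurableSet_eq_fun (by fun_prop) (by fun_prop)).compl
    · filter_upwards [Measure.ae_eval_ne (μ := μ) i (x i)] with y hy using hy.symm
  have hup : ∀ i, ∀ᵐ p ∂((Measure.pi μ).prod (Measure.pi μ)),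
      Function.update p.2 i (p.1 i) ∈ Ω := fun i =>
    (measurePreserving_update i).quasiMeasurePreserving.ae hΩ
  filter_upwards [Measure.quasiMeasurePreserving_fst.ae hΩ,
    Measure.quasiMeasurePreserving_snd.ae hΩ, ae_all_iff.2 hne, ae_all_iff.2 hup] with p h1 h2 h3 h4
  exact hL _ h1 _ h2 fun i => ⟨h3 i, h4 i⟩

theorem abs_dividedDiffOuter_le {v z : Fin d → ℝ} {L : ℝ}
    (h : ‖WithLp.toLp 2 (dividedDiff f v z)‖ ≤ L) (a b : Fin d) :
    |dividedDiffOuter f v z a b| ≤ L ^ 2 := by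
  have h1 : ∀ i, |dividedDiff f v z i| ≤ L := fun i =>
    (PiLp.norm_apply_le (WithLp.toLp 2 (dividedDiff f v z)) i).trans h
  rw [dividedDiffOuter, Matrix.vecMulVec_apply, abs_mul, sq]
  exact mul_le_mul (h1 a) (h1 b) (abs_nonneg _) ((abs_nonneg _).trans (h1 a))

theorem aemeasurable_dividedDiffOuter (hf : AEMeasurable f (Measure.pi μ)) (a b : Fin d) :
    AEMeasurable (fun p : (Fin d → ℝ) × (Fin d → ℝ) => dividedDiffOuter f p.1 p.2 a b)
      ((Measure.pi μ).prod (Measure.pi μ)) := by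
  simp only [dividedDiffOuter, Matrix.vecMulVec_apply]
  exact (aemeasurable_dividedDiff hf a).mul (aemeasurable_dividedDiff hf b)

theorem integrable_dividedDiffOuter {L : ℝ} (hf : AEMeasurable f (Measure.pi μ))
    (hL : ∀ᵐ p ∂((Measure.pi μ).prod (Measure.pi μ)), ‖WithLp.toLp 2 (dividedDiff f p.1 p.2)‖ ≤ L)
    (a b : Fin d) :
    Integrable (fun p : (Fin d → ℝ) × (Fin d → ℝ) => dividedDiffOuter f p.1 p.2 a b)
      ((Measure.pi μ).prod (Measure.pi μ)) :=
  Integrable.of_bound (aemeasurable_dividedDiffOuter hf a b).aestronglyMeasurable (L ^ 2)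
    (hL.mono fun _ hp => abs_dividedDiffOuter_le hp a b)

theorem gasMatrix_apply_eq_integral_prod {L : ℝ} (hf : AEMeasurable f (Measure.pi μ))
    (hL : ∀ᵐ p ∂((Measure.pi μ).prod (Measure.pi μ)), ‖WithLp.toLp 2 (dividedDiff f p.1 p.2)‖ ≤ L)
    (a b : Fin d) :
    gasMatrix μ f a b =
      ∫ p, dividedDiffOuter f p.1 p.2 a b ∂((Measure.pi μ).prod (Measure.pi μ)) := by
  rw [integral_prod_symm _ (integrable_dividedDiffOuter hf hL a b)]
  rfl

/-- The quadratic form is the mean of `(x ⬝ᵥ D) ^ 2`, with `D` the divided-difference vector. -/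
theorem quadForm_gasMatrix_nonneg {L : ℝ} (hf : AEMeasurable f (Measure.pi μ))
    (hL : ∀ᵐ p ∂((Measure.pi μ).prod (Measure.pi μ)), ‖WithLp.toLp 2 (dividedDiff f p.1 p.2)‖ ≤ L)
    (x : Fin d → ℝ) : 0 ≤ x ⬝ᵥ gasMatrix μ f *ᵥ x := by
  have h : x ⬝ᵥ gasMatrix μ f *ᵥ x =
      ∫ p, (x ⬝ᵥ dividedDiff f p.1 p.2) ^ 2 ∂((Measure.pi μ).prod (Measure.pi μ)) := by
    have : ∀ p : (Fin d → ℝ) × (Fin d → ℝ), (x ⬝ᵥ dividedDiff f p.1 p.2) ^ 2 =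
        ∑ a, ∑ b, x a * (dividedDiffOuter f p.1 p.2 a b * x b) := fun p => by
      rw [sq, dotProduct, Finset.sum_mul_sum]
      refine Finset.sum_congr rfl fun a _ => Finset.sum_congr rfl fun b _ => ?_
      rw [dividedDiffOuter, Matrix.vecMulVec_apply]
      ring
    have hI := integrable_dividedDiffOuter hf hL
    simp only [this]
    rw [integral_finsetSum _ fun a _ =>
      integrable_finsetSum _ fun b _ => ((hI a b).mul_const _).const_mul _]
    refine Finset.sum_congr rfl fun a _ => ?_
    rw [integral_finsetSum _ fun b _ => ((hI a b).mul_const _).const_mul _, Matrix.mulVec,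
      dotProduct, Finset.mul_sum]
    refine Finset.sum_congr rfl fun b _ => ?_
    rw [integral_const_mul, integral_mul_const, gasMatrix_apply_eq_integral_prod hf hL]
  rw [h]
  exact integral_nonneg fun _ => sq_nonneg _

/-- The diagonal entries are squares with zero integral, so every divided difference vanishes almost
surely. -/
theorem ae_dividedDiffOuter_eq_zero {L : ℝ} (hf : AEMeasurable f (Measure.pi μ))
    (hL : ∀ᵐ p ∂((Measure.pi μ).prod (Measure.pi μ)), ‖WithLp.toLp 2 (dividedDiff f p.1 p.2)‖ ≤ L)
    (h0 : gasMatrix μ f = 0) :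
    ∀ᵐ p ∂((Measure.pi μ).prod (Measure.pi μ)), dividedDiffOuter f p.1 p.2 = 0 := by
  have h : ∀ a, ∀ᵐ p ∂((Measure.pi μ).prod (Measure.pi μ)), dividedDiffOuter f p.1 p.2 a a = 0 := by
    intro a
    have h1 := gasMatrix_apply_eq_integral_prod hf hL a a
    rw [h0, Matrix.zero_apply] at h1
    exact (integral_eq_zero_iff_of_nonneg (fun p => by
      simpa [dividedDiffOuter, Matrix.vecMulVec_apply] using mul_self_nonneg _)
      (integrable_dividedDiffOuter hf hL a a)).1 h1.symm
  filter_upwards [ae_all_iff.2 h] with p hp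
  ext a b
  have := hp a
  simp only [dividedDiffOuter, Matrix.vecMulVec_apply, mul_self_eq_zero] at this
  simp [dividedDiffOuter, Matrix.vecMulVec_apply, this]

end DividedDifferences

/-! ### Convergence of the Monte Carlo estimator -/

section Sampling

variable {d : ℕ} {μ : Fin d → Measure ℝ}
  {f : (Fin d → ℝ) → ℝ} {S : Type*} [MeasurableSpace S] {P : Measure S}
  {z : ℕ → S → Fin d → ℝ} {v : ℕ → ℕ → S → Fin d → ℝ}

theorem gasEstimator_apply (M₁ M₂ : ℕ) (x : ℕ → Fin d → ℝ) (y : ℕ → ℕ → Fin d → ℝ) (a b : Fin d) :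
    gasEstimator f M₁ M₂ x y a b = 1 / ((M₁ : ℝ) * M₂) *
      ∑ j ∈ Finset.range M₁, ∑ i ∈ Finset.range M₂, dividedDiffOuter f (y j i) (x j) a b := by
  simp [gasEstimator, Matrix.sum_apply]

theorem indepFun_sample_pair (hz : ∀ j, HasLaw (z j) (Measure.pi μ) P)
    (hv : ∀ j i, HasLaw (v j i) (Measure.pi μ) P)
    (hindep : iIndepFun (Sum.elim z fun p : ℕ × ℕ => v p.1 p.2) P) {j j' : ℕ} (h : j ≠ j')
    (i i' : ℕ) :
    IndepFun (fun ω => (v j i ω, z j ω)) (fun ω => (v j' i' ω, z j' ω)) P := by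
  refine hindep.indepFun_prodMk_prodMk₀ ?_ (Sum.inr (j, i)) (Sum.inl j) (Sum.inr (j', i'))
    (Sum.inl j') (by simp [h]) (by simp) (by simp) (by simp [h])
  rintro (k | k)
  · exact (hz k).aemeasurable
  · exact (hv k.1 k.2).aemeasurable

variable [IsProbabilityMeasure P]

theorem hasLaw_sample_pair (hz : ∀ j, HasLaw (z j) (Measure.pi μ) P)
    (hv : ∀ j i, HasLaw (v j i) (Measure.pi μ) P)
    (hindep : iIndepFun (Sum.elim z fun p : ℕ × ℕ => v p.1 p.2) P) (j i : ℕ) :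
    HasLaw (fun ω => (v j i ω, z j ω)) ((Measure.pi μ).prod (Measure.pi μ)) P :=
  IndepFun.hasLaw_prod (hv j i) (hz j)
    (hindep.indepFun (i := Sum.inr (j, i)) (j := Sum.inl j) (by simp))

variable [∀ i, IsProbabilityMeasure (μ i)]

/-- Entrywise concentration of the Monte Carlo estimator. -/
theorem measure_le_abs_gasEstimator_apply_sub_le {L : ℝ} (hf : AEMeasurable f (Measure.pi μ))
    (hL : ∀ᵐ p ∂((Measure.pi μ).prod (Measure.pi μ)), ‖WithLp.toLp 2 (dividedDiff f p.1 p.2)‖ ≤ L)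
    (hz : ∀ j, HasLaw (z j) (Measure.pi μ) P) (hv : ∀ j i, HasLaw (v j i) (Measure.pi μ) P)
    (hindep : iIndepFun (Sum.elim z fun p : ℕ × ℕ => v p.1 p.2) P)
    {M₁ M₂ : ℕ} (hM₁ : 0 < M₁) (hM₂ : 0 < M₂) {δ : ℝ} (hδ : 0 < δ) (a b : Fin d) :
    P {ω | δ ≤ |gasEstimator f M₁ M₂ (fun j => z j ω) (fun j i => v j i ω) a b
        - gasMatrix μ f a b|}
      ≤ ENNReal.ofReal (4 * (L ^ 2) ^ 2 / δ ^ 2 / M₁) := by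
  have hpair := hasLaw_sample_pair hz hv hindep
  have hmeas := aemeasurable_dividedDiffOuter hf a b
  have hmap : ∀ j i, AEMeasurable
      (fun p : (Fin d → ℝ) × (Fin d → ℝ) => dividedDiffOuter f p.1 p.2 a b)
      (P.map fun ω => (v j i ω, z j ω)) := fun j i => by rw [(hpair j i).map_eq]; exact hmeas
  simp only [gasEstimator_apply]
  refine measure_le_abs_average_sub_le (X := fun j i ω => dividedDiffOuter f (v j i ω) (z j ω) a b)
    (fun j i => (hmap j i).comp_aemeasurable (hpair j i).aemeasurable) (fun j i => ?_)
    (fun j i => ?_) (fun j i j' i' h => ?_) hM₁ hM₂ hδ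
  · have := (hpair j i).map_eq ▸ hL
    filter_upwards [ae_of_ae_map (hpair j i).aemeasurable this] with ω hω
    exact abs_dividedDiffOuter_le hω a b
  · rw [gasMatrix_apply_eq_integral_prod hf hL]
    exact (hpair j i).integral_comp hmeas.aestronglyMeasurable
  · exact (indepFun_sample_pair hz hv hindep h i i').comp₀ (hpair j i).aemeasurable
      (hpair j' i').aemeasurable (hmap j i) (hmap j' i')

theorem ae_gasEstimator_eq_zero {L : ℝ} (hf : AEMeasurable f (Measure.pi μ))
    (hL : ∀ᵐ p ∂((Measure.pi μ).prod (Measure.pi μ)), ‖WithLp.toLp 2 (dividedDiff f p.1 p.2)‖ ≤ L)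
    (hz : ∀ j, HasLaw (z j) (Measure.pi μ) P) (hv : ∀ j i, HasLaw (v j i) (Measure.pi μ) P)
    (hindep : iIndepFun (Sum.elim z fun p : ℕ × ℕ => v p.1 p.2) P) (h0 : gasMatrix μ f = 0)
    (M₁ M₂ : ℕ) : ∀ᵐ ω ∂P, gasEstimator f M₁ M₂ (fun j => z j ω) (fun j i => v j i ω) = 0 := by
  have h : ∀ j i, ∀ᵐ ω ∂P, dividedDiffOuter f (v j i ω) (z j ω) = 0 := fun j i => by
    have hpair := hasLaw_sample_pair hz hv hindep j i
    exact ae_of_ae_map hpair.aemeasurable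
      (hpair.map_eq ▸ ae_dividedDiffOuter_eq_zero hf hL h0 :
        ∀ᵐ p ∂(P.map fun ω => (v j i ω, z j ω)), dividedDiffOuter f p.1 p.2 = 0)
  filter_upwards [ae_all_iff.2 fun j => ae_all_iff.2 (h j)] with ω hω
  simp [gasEstimator, hω]

/-- Matrices with small entries have small spectral norm. -/
theorem exists_entry_bound_imp_norm_le (d : ℕ) {r : ℝ} (hr : 0 < r) :
    ∃ δ > 0, ∀ A : Matrix (Fin d) (Fin d) ℝ, (∀ a b, |A a b| < δ) → ‖A‖ ≤ r := by
  have hcont : Continuous fun A : Fin d → Fin d → ℝ => ‖(Matrix.of A : Matrix (Fin d) (Fin d) ℝ)‖ :=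
    (continuous_norm (E := Matrix (Fin d) (Fin d) ℝ)).comp
      (continuous_matrix fun a b => (continuous_apply b).comp (continuous_apply a))
  obtain ⟨δ, hδ, h⟩ := Metric.continuousAt_iff.1 (hcont.continuousAt (x := 0)) r hr
  refine ⟨δ, hδ, fun A hA => ?_⟩
  have h1 : dist (show Fin d → Fin d → ℝ from A) 0 < δ :=
    (dist_pi_lt_iff hδ).2 fun a => (dist_pi_lt_iff hδ).2 fun b => by
      simpa [Real.dist_eq] using hA a b
  have h2 := h h1
  have h3 : (Matrix.of (0 : Fin d → Fin d → ℝ) : Matrix (Fin d) (Fin d) ℝ) = 0 := rfl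
  rw [h3, norm_zero, Real.dist_eq, sub_zero, abs_of_nonneg (norm_nonneg _)] at h2
  exact h2.le

/-- The estimator has small relative error with high probability. -/
theorem exists_forall_measure_gasEstimator_error_le {L : ℝ} (hf : AEMeasurable f (Measure.pi μ))
    (hL : ∀ᵐ p ∂((Measure.pi μ).prod (Measure.pi μ)), ‖WithLp.toLp 2 (dividedDiff f p.1 p.2)‖ ≤ L)
    (hz : ∀ j, HasLaw (z j) (Measure.pi μ) P) (hv : ∀ j i, HasLaw (v j i) (Measure.pi μ) P)
    (hindep : iIndepFun (Sum.elim z fun p : ℕ × ℕ => v p.1 p.2) P)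
    {ε η : ℝ} (hε : 0 < ε) (hη : 0 < η) :
    ∃ M₀ : ℕ, ∀ M₁ M₂ : ℕ, M₀ ≤ M₁ → M₀ ≤ M₂ →
      P {ω | ¬ ‖gasEstimator f M₁ M₂ (fun j => z j ω) (fun j i => v j i ω) - gasMatrix μ f‖
        ≤ ε * ‖gasMatrix μ f‖} ≤ ENNReal.ofReal η := by
  -- When `C = 0` a relative error bound demands exact equality, so concentration does not suffice.
  by_cases h0 : gasMatrix μ f = 0
  · refine ⟨0, fun M₁ M₂ _ _ => ?_⟩
    refine (le_of_eq ?_).trans zero_le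
    refine ae_iff.1 ?_
    filter_upwards [ae_gasEstimator_eq_zero hf hL hz hv hindep h0 M₁ M₂] with ω hω
    simp [hω, h0]
  obtain ⟨δ, hδ, hδn⟩ := exists_entry_bound_imp_norm_le d (mul_pos hε (norm_pos_iff.2 h0))
  set κ := 4 * (L ^ 2) ^ 2 / δ ^ 2 with hκ
  have hκ0 : 0 ≤ κ := by positivity
  -- Each of the `d * d` entries fails with probability at most `κ / M₁`. Taking `N + 1` below makes
  -- `M₁` and `M₂` positive, which is all that is needed of `M₂`.
  obtain ⟨N, hN⟩ := exists_nat_ge ((d : ℝ) * d * κ / η)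
  refine ⟨N + 1, fun M₁ M₂ h1 h2 => ?_⟩
  have hM₁ : 0 < M₁ := by omega
  have hM₂ : 0 < M₂ := by omega
  set bad : Fin d → Fin d → Set S := fun a b =>
    {ω | δ ≤ |gasEstimator f M₁ M₂ (fun j => z j ω) (fun j i => v j i ω) a b - gasMatrix μ f a b|}
  have hsub : {ω | ¬ ‖gasEstimator f M₁ M₂ (fun j => z j ω) (fun j i => v j i ω) - gasMatrix μ f‖
        ≤ ε * ‖gasMatrix μ f‖} ⊆ ⋃ a, ⋃ b, bad a b := by
    intro ω hω
    by_contra hcon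
    simp only [Set.mem_iUnion, not_exists] at hcon
    exact hω (hδn _ fun a b => not_le.1 (hcon a b))
  calc _ ≤ P (⋃ a, ⋃ b, bad a b) := measure_mono hsub
    _ ≤ ∑ a, ∑ b, P (bad a b) :=
      (measure_iUnion_fintype_le P _).trans (by gcongr; exact measure_iUnion_fintype_le P _)
    _ ≤ ∑ _a : Fin d, ∑ _b : Fin d, ENNReal.ofReal (κ / M₁) := by
      gcongr with a _ b _
      exact measure_le_abs_gasEstimator_apply_sub_le hf hL hz hv hindep hM₁ hM₂ hδ a b
    _ = ENNReal.ofReal ((d : ℝ) * d * (κ / M₁)) := by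
      rw [ENNReal.ofReal_mul (by positivity), ENNReal.ofReal_mul (by positivity)]
      simp [mul_assoc]
    _ ≤ ENNReal.ofReal η := by
      refine ENNReal.ofReal_le_ofReal ?_
      have hM : ((N : ℝ)) ≤ M₁ := by exact_mod_cast (by omega : N ≤ M₁)
      have hMp : (0 : ℝ) < M₁ := by exact_mod_cast hM₁
      rw [← mul_div_assoc, div_le_iff₀ hMp]
      have := hN.trans hM
      rw [div_le_iff₀ hη] at this
      linarith

end Sampling

/-! ### Error and subspace bounds on one event -/

/-- Matrix norms are spectral norms. Indices start at `0` in Lean, so `lam ⟨0, _⟩`,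
`lam ⟨d₁ - 1, _⟩` and `lam ⟨d₁, _⟩` are the eigenvalues `λ₁`, `λ_{d₁}` and `λ_{d₁+1}`. -/
theorem theorem4p3 {d d₁ : ℕ} (hd₁ : 0 < d₁) (hd : d₁ < d)
    -- the marginal distributions: continuous probability distributions on the line
    (μ : Fin d → Measure ℝ) [∀ i, IsProbabilityMeasure (μ i)] [∀ i, NullSingletonClass (μ i)]
    -- the domain, and `f` Lipschitz on it with bounded divided differences
    (Ω : Set (Fin d → ℝ)) (hΩ : ∀ᵐ z ∂(Measure.pi μ), z ∈ Ω)
    (f : (Fin d → ℝ) → ℝ)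
    (hf : ∃ K : ℝ, ∀ x ∈ Ω, ∀ y ∈ Ω, |f x - f y| ≤ K * ‖WithLp.toLp 2 (x - y)‖)
    (L : ℝ)
    (hL : ∀ v ∈ Ω, ∀ z ∈ Ω, (∀ i, v i ≠ z i ∧ Function.update z i (v i) ∈ Ω) →
      ‖WithLp.toLp 2 (dividedDiff f v z)‖ ≤ L)
    -- the eigenvalue decomposition of `C`
    (U : Matrix (Fin d) (Fin d) ℝ) (lam : Fin d → ℝ)
    (hU : IsOrderedEigendecomposition (gasMatrix μ f) U lam)
    (hgap : lam ⟨d₁, hd⟩ < lam ⟨d₁ - 1, by omega⟩)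
    (ε' ε'' : ℝ) (hε' : 0 < ε') (hε'' : 0 < ε'')
    -- the samples: all the `z j` and `v j i` are independent and have the product distribution
    {S : Type*} [MeasurableSpace S] (P : Measure S) [IsProbabilityMeasure P]
    (z : ℕ → S → Fin d → ℝ) (v : ℕ → ℕ → S → Fin d → ℝ)
    (hz : ∀ j, HasLaw (z j) (Measure.pi μ) P)
    (hv : ∀ j i, HasLaw (v j i) (Measure.pi μ) P)
    (hindep : iIndepFun (Sum.elim z fun p : ℕ × ℕ => v p.1 p.2) P) :
    ∀ η : ℝ, 0 < η → ∃ M₀ : ℕ, ∀ M₁ M₂ : ℕ, M₀ ≤ M₁ → M₀ ≤ M₂ →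
      ∃ G : Set S, MeasurableSet G ∧ 1 - η ≤ P.real G ∧ ∀ ω ∈ G,
        ‖gasEstimator f M₁ M₂ (fun j => z j ω) (fun j i => v j i ω) - gasMatrix μ f‖
            ≤ ε'' / M₁ * ∑ j ∈ Finset.range M₁, ‖condGasMatrix μ f (z j ω)‖
              + ε' * ‖gasMatrix μ f‖ ∧
        (ε'' / M₁ * ∑ j ∈ Finset.range M₁, ‖condGasMatrix μ f (z j ω)‖ + ε' * lam ⟨0, by omega⟩
            ≤ (lam ⟨d₁ - 1, by omega⟩ - lam ⟨d₁, hd⟩) / 5 →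
          ∀ (Uhat : Matrix (Fin d) (Fin d) ℝ) (lamhat : Fin d → ℝ),
            IsOrderedEigendecomposition
              (gasEstimator f M₁ M₂ (fun j => z j ω) (fun j i => v j i ω)) Uhat lamhat →
            ‖(leadingColumns d₁ U)ᵀ * trailingColumns d₁ Uhat‖
              ≤ 4 * (ε'' / M₁ * ∑ j ∈ Finset.range M₁, ‖condGasMatrix μ f (z j ω)‖
                  + ε' * lam ⟨0, by omega⟩)
                / (lam ⟨d₁ - 1, by omega⟩ - lam ⟨d₁, hd⟩)) := by
  intro η hη
  have hfm : AEMeasurable f (Measure.pi μ) := aemeasurable_of_lipschitz_on hΩ hf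
  have hLae := ae_norm_dividedDiff_le hΩ hL
  obtain ⟨M₀, hM₀⟩ :=
    exists_forall_measure_gasEstimator_error_le hfm hLae hz hv hindep hε' hη
  refine ⟨M₀, fun M₁ M₂ h1 h2 => ?_⟩
  set bad : Set S :=
    {ω | ¬ ‖gasEstimator f M₁ M₂ (fun j => z j ω) (fun j i => v j i ω) - gasMatrix μ f‖
      ≤ ε' * ‖gasMatrix μ f‖}
  have hbad : P.real (toMeasurable P bad) ≤ η := by
    rw [measureReal_def, measure_toMeasurable]
    exact ENNReal.toReal_le_of_le_ofReal hη.le (hM₀ M₁ M₂ h1 h2)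
  -- `bad` is not known to be measurable, since `f` is only a.e. measurable; its measurable hull has
  -- the same measure.
  refine ⟨(toMeasurable P bad)ᶜ, (measurableSet_toMeasurable P bad).compl, ?_, fun ω hω => ?_⟩
  · rw [probReal_compl_eq_one_sub (measurableSet_toMeasurable P bad)]
    linarith
  have hω' : ‖gasEstimator f M₁ M₂ (fun j => z j ω) (fun j i => v j i ω) - gasMatrix μ f‖
      ≤ ε' * ‖gasMatrix μ f‖ := by
    by_contra hcon
    exact hω (subset_toMeasurable P bad hcon)
  have havg : 0 ≤ ε'' / M₁ * ∑ j ∈ Finset.range M₁, ‖condGasMatrix μ f (z j ω)‖ :=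
    mul_nonneg (by positivity) (Finset.sum_nonneg fun _ _ => norm_nonneg _)
  have hle := hω'.trans (le_add_of_nonneg_left havg)
  refine ⟨hle, fun hsmall Uhat lamhat hhat => ?_⟩
  have hnorm : ‖gasMatrix μ f‖ ≤ lam ⟨0, by omega⟩ :=
    hU.norm_le (quadForm_gasMatrix_nonneg hfm hLae) _
  exact norm_leadingColumns_transpose_mul_trailingColumns_le rfl rfl hU hhat hgap
    (hle.trans (by gcongr)) hsmall
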